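/- Let $X^*$ be the set of finite words over $\{0,1\}$, regarded as the vertex set of the infinite rooted binary tree. The (first) Grigorchuk group is the group $\Gamma=\langle a,b,c,d\rangle$ of permutations (in fact tree automorphisms) of $X^*$, where $a,b,c,d$ fix the empty word and, for every $w\in X^*$, \[a(0w)=1w,\quad a(1w)=0w,\quad b(0w)=0\,a(w),\quad b(1w)=1\,c(w),\] \[c(0w)=0\,a(w),\quad c(1w)=1\,d(w),\quad d(0w)=0w,\quad d(1w)=1\,b(w).\] The group $\Gamma$ is intersection-saturated: for every integer $n\geq 1$ and every map $c\colon \mathcal{P}(\{1,\dots,n\})\setminus\{\emptyset\}\to\{0,1\}$ there exist subgroups $H_1,\dots,H_n\leq \Gamma$ such that for every non-empty subset $I\subseteq\{1,\dots,n\}$, the subgroup $\bigcap_{i\in I}H_i$ is finitely generated if and only if $c(I)=0$. -/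

import Mathlib

/-- An `n`-configuration: a map from the nonempty subsets of an `n`-element set to `{0, 1}`. -/
abbrev IntersectionConfiguration (n : ℕ) : Type :=
  {I : Finset (Fin n) // I.Nonempty} → Fin 2

/-- A configuration `c` is realisable in `G` if there are subgroups `H₁, …, Hₙ` of `G` such that,
for every nonempty `I`, the intersection of the `H i`, `i ∈ I`, is finitely generated
if and only if `c I = 0`. -/
def IntersectionConfiguration.Realisable {n : ℕ} (c : IntersectionConfiguration n)
    (G : Type*) [Group G] : Prop :=
  ∃ H : Fin n → Subgroup G,
    ∀ I : {I : Finset (Fin n) // I.Nonempty}, (⨅ i ∈ I.1, H i).FG ↔ c I = 0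

/-- A group is intersection-saturated if for every `n ≥ 1` every `n`-configuration
is realisable in it. -/
def IntersectionSaturated (G : Type*) [Group G] : Prop :=
  ∀ n : ℕ, 1 ≤ n → ∀ c : IntersectionConfiguration n, c.Realisable G

namespace Grigorchuk

/-- Names for the four standard generators of the Grigorchuk group. -/
inductive Gen : Type
  | a | b | c | d

/-- The action of the generators on the vertices of the rooted binary tree, that is, on the finite
words over `{0, 1}` (`false` is `0`, `true` is `1`): `a` exchanges the two subtrees hanging from
the root, and, in terms of the first-level decomposition,
`b = (a, c)`, `c = (a, d)`, `d = (1, b)`. -/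
def act : Gen → List Bool → List Bool
  | _, [] => []
  | .a, x :: w => (!x) :: w
  | .b, false :: w => false :: act .a w
  | .b, true :: w => true :: act .c w
  | .c, false :: w => false :: act .a w
  | .c, true :: w => true :: act .d w
  | .d, false :: w => false :: w
  | .d, true :: w => true :: act .b w

theorem act_involutive (s : Gen) : Function.Involutive (act s) := by
  intro w
  induction w generalizing s with
  | nil => cases s <;> rfl
  | cons x w ih => cases s <;> cases x <;> simp [act, ih]

/-- The generators as permutations of the vertex set of the rooted binary tree. -/
def genPerm (s : Gen) : Equiv.Perm (List Bool) := (act_involutive s).toPerm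

end Grigorchuk

/-- The (first) Grigorchuk group, generated by `a`, `b`, `c`, `d` inside the group of permutations
of the vertices of the rooted binary tree. -/
def grigorchukGroup : Subgroup (Equiv.Perm (List Bool)) :=
  Subgroup.closure (Set.range Grigorchuk.genPerm)

/-! The proof separates a general criterion (`IntersectionSaturated.of_direct_powers`) from its
verification for the Grigorchuk group `Γ`.

Criterion: let `φ` be an automorphism of a finitely generated group `H` with `Fix φ` not finitely
generated. Label the vertices of an `n`-cycle by elements of `H`, each edge imposing equality of its
end labels, except one edge that imposes `φ`. If an edge is omitted, the solutions form a power of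
`H`; with all edges present, they project onto `Fix φ`. Distributing the edges among the subgroups
makes exactly one prescribed intersection infinitely generated (`iInf_block_fg_iff`), and a direct
product over all `I` with `c I ≠ 0` realises `c`.

For `Γ`: `H` is a normal subgroup of finite index whose `M`-th power embeds in `Γ` below the
vertices `1ⁱ0`, and `φ` is conjugation by `b`. An element of `Γ` commuting with `b` fixes some `1ᴺ`
and acts below it as an element of `⟨b, c, d⟩` (`exists_mem_raySubgroup`). These conditions form an
ascending chain of subgroups, so a finitely generated centralizer would satisfy one of them; yet
each fails for some element of `H` commuting with `b` (`exists_commute_notMem_raySubgroup`). -/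

/-- The subgroup of fixed points of an automorphism. -/
def MulEquiv.fixedSubgroup {H : Type*} [Group H] (φ : H ≃* H) : Subgroup H :=
  φ.toMonoidHom.eqLocus (MonoidHom.id H)

theorem Subgroup.FG.map_hom {G K : Type*} [Group G] [Group K] {P : Subgroup G} (h : P.FG)
    (f : G →* K) : (P.map f).FG := by
  rw [← Group.fg_iff_subgroup_fg] at h ⊢
  exact Group.fg_of_surjective (f.subgroupMap_surjective P)

namespace IntersectionConfiguration

/-! ### Twisted labellings of a cycle. -/

section Cycle

variable {H : Type*} [Group H] (φ : H ≃* H) {m : ℕ}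

/-- The automorphism attached to the edge from `l` to `l + 1` of the cycle: it is `φ` on the
edge starting at `0`, and trivial on the other ones. -/
def edgeAut (l : Fin (m + 1)) : H ≃* H := if l = 0 then φ else MulEquiv.refl H

/-- The labellings of the vertices of a cycle that are compatible with the edges in `S`. -/
def cycleSubgroup (S : Finset (Fin (m + 1))) : Subgroup (Fin (m + 1) → H) where
  carrier := {h | ∀ l ∈ S, h (l + 1) = edgeAut φ l (h l)}
  one_mem' := by simp
  mul_mem' := by
    intro x y hx hy l hl
    simp [hx l hl, hy l hl]
  inv_mem' := by
    intro x hx l hl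
    simp [hx l hl]

/-- Labellings of the cycle cut at `j`, untwisted. -/
def untwist (j i : Fin (m + 1)) : H ≃* H := if 0 < i ∧ i ≤ j then φ else MulEquiv.refl H

/-- Once the edge leaving `j` is cut, the cycle is a path from `j + 1` through `0` to `j`; the twist
is met only on the edge from `0` to `1`, so precisely the vertices `1, …, j` carry `φ`. -/
theorem untwist_succ {j l : Fin (m + 1)} (hl : l ≠ j) (x : H) :
    untwist φ j (l + 1) x = edgeAut φ l (untwist φ j l x) := by
  unfold untwist edgeAut
  have hlj : l.1 ≠ j.1 := fun h => hl (Fin.ext h)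
  have hj := j.2
  by_cases hlast : l = Fin.last m
  · subst hlast
    have h0 : ¬ (Fin.last m ≤ j) := fun h => by
      have : m ≤ j.1 := h
      simp at hlj
      omega
    have h1 : Fin.last m ≠ 0 := by
      intro h
      apply h0
      rw [h]
      exact Fin.zero_le _
    simp [h0, h1]
  · have hval : (l + 1).1 = l.1 + 1 := Fin.val_add_one_of_lt (Fin.lt_last_iff_ne_last.2 hlast)
    simp only [Fin.lt_def, Fin.le_def, hval, Fin.ext_iff, Fin.val_zero]
    by_cases h0 : l.1 = 0
    · have h1 : 0 < j.1 := by omega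
      simp [h0, Nat.succ_le_iff, h1]
    · by_cases h1 : l.1 ≤ j.1
      · have h2 : l.1 + 1 ≤ j.1 := by omega
        simp [h0, h1, h2, Nat.pos_of_ne_zero h0]
      · have h2 : ¬ l.1 + 1 ≤ j.1 := by omega
        simp [h0, h1, h2]

/-- After untwisting, a compatible labelling is one that is constant on the components of the graph
with edge set `S`, so the subgroup is a finite power of `H`. -/
theorem cycleSubgroup_fg [Group.FG H] {S : Finset (Fin (m + 1))} {j : Fin (m + 1)} (hj : j ∉ S) :
    (cycleSubgroup φ S).FG := by
  let r : Fin (m + 1) → Fin (m + 1) → Prop := fun i k => i ∈ S ∧ k = i + 1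
  have : Finite (Quot r) := Quot.finite r
  let F : (Quot r → H) →* (Fin (m + 1) → H) :=
    MonoidHom.pi fun i => (untwist φ j i).toMonoidHom.comp (Pi.evalMonoidHom _ (Quot.mk r i))
  have hF : ∀ f i, F f i = untwist φ j i (f (Quot.mk r i)) := fun _ _ => rfl
  have hne : ∀ l ∈ S, l ≠ j := fun l hl h => hj (h ▸ hl)
  have key : cycleSubgroup φ S = F.range := by
    ext h
    constructor
    · intro hh
      refine ⟨Quot.lift (fun i => (untwist φ j i).symm (h i)) ?_, ?_⟩
      · rintro i k ⟨hi, rfl⟩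
        rw [MulEquiv.eq_symm_apply, untwist_succ φ (hne i hi), hh i hi, MulEquiv.apply_symm_apply]
      · ext i
        simp [hF]
    · rintro ⟨f, rfl⟩ l hl
      rw [hF, hF, untwist_succ φ (hne l hl)]
      have : Quot.mk r l = Quot.mk r (l + 1) := Quot.sound ⟨hl, rfl⟩
      rw [this]
  rw [key, ← Group.fg_iff_subgroup_fg]
  infer_instance

/-- Going once around the cycle from vertex `0` applies `φ` exactly once. -/
theorem map_cycleSubgroup_univ :
    (cycleSubgroup φ (Finset.univ : Finset (Fin (m + 1)))).map (Pi.evalMonoidHom _ 0) =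
      φ.fixedSubgroup := by
  ext x
  constructor
  · rintro ⟨h, hh, rfl⟩
    change φ (h 0) = h 0
    have h1 : ∀ i : Fin (m + 1), i ≠ 0 → h (i + 1) = h i := by
      intro i hi
      simpa [edgeAut, hi] using hh i (Finset.mem_univ i)
    have h0 : h (0 + 1) = φ (h 0) := by simpa [edgeAut] using hh 0 (Finset.mem_univ _)
    have h2 : ∀ k : ℕ, ∀ hk : k < m + 1, h (⟨k, hk⟩ + 1) = φ (h 0) := by
      intro k
      induction k with
      | zero => intro _; exact h0
      | succ k ih =>
        intro hk
        have e : (⟨k + 1, hk⟩ : Fin (m + 1)) = ⟨k, by omega⟩ + 1 := by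
          ext
          rw [Fin.val_add_one_of_lt]
          simp [Fin.lt_def]; omega
        rw [h1 _ (by simp [Fin.ext_iff]), e, ih]
    have := h2 m (by omega)
    rw [← this]
    congr 1
    exact Fin.last_add_one m
  · intro hx
    refine ⟨fun _ => x, fun l _ => ?_, rfl⟩
    have hx' : φ x = x := hx
    unfold edgeAut
    split_ifs <;> simp [hx']

end Cycle

/-! ### Realising configurations by products of blocks. -/

section Realise

variable {H : Type*} [Group H] (φ : H ≃* H) {m : ℕ}

/-- Subgroups whose intersection over `J` is not finitely generated exactly for `J = I`. -/
def block (I : Finset (Fin (m + 1))) (i : Fin (m + 1)) :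
    Subgroup (Fin (m + 1) → H) :=
  if i ∈ I then cycleSubgroup φ (insert i Iᶜ) else ⊥

theorem iInf_block_of_subset {I J : Finset (Fin (m + 1))} (hJ : J.Nonempty) (h : J ⊆ I) :
    ⨅ i ∈ J, block φ I i = cycleSubgroup φ (J ∪ Iᶜ) := by
  ext x
  simp only [Subgroup.mem_iInf]
  constructor
  · intro hx l hl
    obtain ⟨j, hj⟩ := hJ
    rcases Finset.mem_union.1 hl with hl | hl
    · have := hx l hl
      rw [block, if_pos (h hl)] at this
      exact this l (Finset.mem_insert_self _ _)
    · have := hx j hj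
      rw [block, if_pos (h hj)] at this
      exact this l (Finset.mem_insert_of_mem hl)
  · intro hx i hi
    rw [block, if_pos (h hi)]
    intro l hl
    apply hx
    rcases Finset.mem_insert.1 hl with rfl | hl
    · exact Finset.mem_union_left _ hi
    · exact Finset.mem_union_right _ hl

/-- If `J ⊄ I` some factor is trivial; if `J ⊂ I` the edges in `I \ J` stay free; only `J = I`
closes the cycle. -/
theorem iInf_block_fg_iff [Group.FG H] (hφ : ¬ φ.fixedSubgroup.FG) {I J : Finset (Fin (m + 1))}
    (hJ : J.Nonempty) : (⨅ i ∈ J, block φ I i).FG ↔ J ≠ I := by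
  by_cases h : J ⊆ I
  · rw [iInf_block_of_subset φ hJ h]
    constructor
    · rintro hfg rfl
      rw [Finset.union_compl] at hfg
      apply hφ
      rw [← map_cycleSubgroup_univ φ (m := m)]
      exact Subgroup.FG.map_hom hfg _
    · intro hne
      obtain ⟨j, hjI, hjJ⟩ := Finset.exists_of_ssubset (h.ssubset_of_ne hne)
      exact cycleSubgroup_fg φ (j := j) (by simp [hjI, hjJ])
  · obtain ⟨i, hiJ, hiI⟩ := Finset.not_subset.1 h
    have : ⨅ i ∈ J, block φ I i = ⊥ := by
      rw [eq_bot_iff]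
      refine (iInf₂_le i hiJ).trans ?_
      rw [block, if_neg hiI]
    rw [this]
    exact ⟨fun _ hh => h (hh ▸ subset_rfl), fun _ => Subgroup.FG.bot⟩

end Realise

theorem subgroup_pi_fg_iff {ι : Type*} [Finite ι] {G : ι → Type*} [∀ i, Group (G i)]
    (P : ∀ i, Subgroup (G i)) : (Subgroup.pi Set.univ P).FG ↔ ∀ i, (P i).FG := by
  classical
  refine ⟨fun h i => ?_, Subgroup.FG.pi⟩
  have : (Subgroup.pi Set.univ P).map (Pi.evalMonoidHom G i) = P i := by
    ext x
    constructor
    · rintro ⟨f, hf, rfl⟩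
      exact hf i (Set.mem_univ i)
    · intro hx
      refine ⟨Pi.mulSingle i x, fun k _ => ?_, by simp⟩
      by_cases hk : k = i
      · subst hk; simpa using hx
      · simp [Pi.mulSingle_eq_of_ne hk, one_mem]
  rw [← this]
  exact Subgroup.FG.map_hom h _

theorem subgroup_map_fg_iff {G K : Type*} [Group G] [Group K] {f : G →* K}
    (hf : Function.Injective f) (P : Subgroup G) : (P.map f).FG ↔ P.FG := by
  refine ⟨fun h => ?_, fun h => Subgroup.FG.map_hom h f⟩
  rw [← Group.fg_iff_subgroup_fg] at h ⊢
  exact Group.fg_of_surjective (f := (P.equivMapOfInjective f hf).symm.toMonoidHom)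
    (P.equivMapOfInjective f hf).symm.surjective

theorem iInf_pi {ι κ : Type*} {G : ι → Type*} [∀ i, Group (G i)] (J : Finset κ)
    (P : κ → ∀ i, Subgroup (G i)) :
    ⨅ k ∈ J, Subgroup.pi Set.univ (P k) = Subgroup.pi Set.univ fun i => ⨅ k ∈ J, P k i := by
  ext x
  simp only [Subgroup.mem_iInf, Subgroup.mem_pi]
  exact ⟨fun h i hi k hk => h k hk i hi, fun h k hk i hi => h i hi k hk⟩

end IntersectionConfiguration

open IntersectionConfiguration in
/-- A group containing arbitrarily high direct powers of finitely generated groups with an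
automorphism whose fixed points are not finitely generated is intersection-saturated. -/
theorem IntersectionSaturated.of_direct_powers {G : Type*} [Group G]
    (h : ∀ M : ℕ, ∃ (H : Subgroup G) (φ : H ≃* H) (f : (Fin M → H) →* G),
      H.FG ∧ Function.Injective f ∧ ¬ φ.fixedSubgroup.FG) : IntersectionSaturated G := by
  rintro n hn c
  obtain ⟨m, rfl⟩ : ∃ m, n = m + 1 := ⟨n - 1, by omega⟩
  let ι := {I : {I : Finset (Fin (m + 1)) // I.Nonempty} // c I ≠ 0}
  -- One copy of `H` for each vertex of each cycle, with one cycle for each `I` such that `c I ≠ 0`.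
  obtain ⟨M, ⟨e⟩⟩ := Finite.exists_equiv_fin (ι × Fin (m + 1))
  obtain ⟨H, φ, f, hH, hf, hφ⟩ := h M
  have : Group.FG H := (Group.fg_iff_subgroup_fg H).2 hH
  let F : (ι → Fin (m + 1) → H) →* G := f.comp
    (MonoidHom.pi fun k => (Pi.evalMonoidHom (fun _ => H) (e.symm k).2).comp
      (Pi.evalMonoidHom (fun _ => Fin (m + 1) → H) (e.symm k).1))
  have hF : Function.Injective F := by
    intro x y hxy
    have hxy' := hf hxy
    ext1 i
    ext1 j
    have : x (e.symm (e (i, j))).1 (e.symm (e (i, j))).2 =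
        y (e.symm (e (i, j))).1 (e.symm (e (i, j))).2 := congrFun hxy' (e (i, j))
    simpa only [Equiv.symm_apply_apply] using this
  refine ⟨fun i => (Subgroup.pi Set.univ fun I : ι => block φ I.1.1 i).map F, fun J => ?_⟩
  have : Nonempty {i // i ∈ J.1} := J.2.to_subtype
  have key : ⨅ i ∈ J.1, (Subgroup.pi Set.univ fun I : ι => block φ I.1.1 i).map F =
      (Subgroup.pi Set.univ fun I : ι => ⨅ i ∈ J.1, block φ I.1.1 i).map F := by
    rw [← iInf_pi, iInf_subtype', iInf_subtype', Subgroup.map_iInf _ hF]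
  rw [key, subgroup_map_fg_iff hF, subgroup_pi_fg_iff]
  simp only [iInf_block_fg_iff φ hφ J.2]
  constructor
  · intro hJ
    by_contra hc
    exact hJ ⟨J, hc⟩ rfl
  · rintro hc I hI
    exact I.2 (by rw [← Subtype.ext hI]; exact hc)

/-! ### Self-similarity of the Grigorchuk group. -/

namespace Grigorchuk

/-- The pair `(f, g)` as a permutation of the tree: `f` acts on the subtree below `0` and `g` on
the subtree below `1`. -/
def pair : Equiv.Perm (List Bool) × Equiv.Perm (List Bool) →* Equiv.Perm (List Bool) where
  toFun p :=
    { toFun := fun w => match w with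
        | [] => []
        | false :: w => false :: p.1 w
        | true :: w => true :: p.2 w
      invFun := fun w => match w with
        | [] => []
        | false :: w => false :: p.1.symm w
        | true :: w => true :: p.2.symm w
      left_inv := by rintro (_ | ⟨_ | _, w⟩) <;> simp
      right_inv := by rintro (_ | ⟨_ | _, w⟩) <;> simp }
  map_one' := by ext1 (_ | ⟨_ | _, w⟩) <;> rfl
  map_mul' p q := by ext1 (_ | ⟨_ | _, w⟩) <;> rfl

@[simp] theorem pair_false (p) (w : List Bool) : pair p (false :: w) = false :: p.1 w := rfl
@[simp] theorem pair_true (p) (w : List Bool) : pair p (true :: w) = true :: p.2 w := rfl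

theorem pair_injective : Function.Injective pair := by
  rintro ⟨f, g⟩ ⟨f', g'⟩ h
  ext1
  · ext1 w
    simpa using congrArg (fun e : Equiv.Perm (List Bool) => e (false :: w)) h
  · ext1 w
    simpa using congrArg (fun e : Equiv.Perm (List Bool) => e (true :: w)) h

/-- The copy of a permutation acting on the subtree below `0`. -/
def left : Equiv.Perm (List Bool) →* Equiv.Perm (List Bool) :=
  pair.comp (MonoidHom.inl _ _)

/-- The copy of a permutation acting on the subtree below `1`. -/
def right : Equiv.Perm (List Bool) →* Equiv.Perm (List Bool) :=
  pair.comp (MonoidHom.inr _ _)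

theorem left_apply (g) : left g = pair (g, 1) := rfl
theorem right_apply (g) : right g = pair (1, g) := rfl

theorem left_mul_right (f g) : left f * right g = pair (f, g) := by
  rw [left_apply, right_apply, ← map_mul]
  simp

/-- The generators. -/
abbrev a := genPerm .a
abbrev b := genPerm .b
abbrev c := genPerm .c
abbrev d := genPerm .d

theorem genPerm_apply (s : Gen) (w : List Bool) : genPerm s w = act s w := rfl

theorem b_eq : b = pair (a, c) := by ext1 (_ | ⟨_ | _, w⟩) <;> rfl
theorem c_eq : c = pair (a, d) := by ext1 (_ | ⟨_ | _, w⟩) <;> rfl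
theorem d_eq : d = pair (1, b) := by ext1 (_ | ⟨_ | _, w⟩) <;> rfl

theorem a_mul_pair_mul_a (f g) : a * pair (f, g) * a = pair (g, f) := by
  ext1 (_ | ⟨_ | _, w⟩) <;> rfl

theorem genPerm_mul_self (s : Gen) : genPerm s * genPerm s = 1 := by
  ext1 w
  exact act_involutive s w

theorem genPerm_inv (s : Gen) : (genPerm s)⁻¹ = genPerm s :=
  inv_eq_of_mul_eq_one_left (genPerm_mul_self s)

theorem genPerm_mem (s : Gen) : genPerm s ∈ grigorchukGroup :=
  Subgroup.subset_closure ⟨s, rfl⟩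

instance : Finite Gen :=
  Finite.of_injective (fun s : Gen => match s with
    | .a => (0 : Fin 4) | .b => 1 | .c => 2 | .d => 3)
    (by rintro (_ | _) (_ | _) h <;> simp_all)

instance : Group.FG grigorchukGroup :=
  Group.closure_finite_fg _

theorem pair_swap_mem {f g} (h : pair (f, g) ∈ grigorchukGroup) :
    pair (g, f) ∈ grigorchukGroup := by
  rw [← a_mul_pair_mul_a f g]
  exact mul_mem (mul_mem (genPerm_mem _) h) (genPerm_mem _)

/-! ### Finite index of the copies of the group in itself -/

/-- The dihedral group generated by `a` and `d`. -/
def dihedral : Subgroup (Equiv.Perm (List Bool)) := Subgroup.closure {a, d}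

instance finite_dihedral : Finite dihedral := by
  -- Normal form `aᵖ (b^q, b^r)`: `d = (1, b)`, and conjugation by `a` swaps the coordinates, so
  -- there are at most 8 elements.
  let f : Bool × Bool × Bool → Equiv.Perm (List Bool) := fun p =>
    (if p.1 then a else 1) * pair (if p.2.1 then b else 1, if p.2.2 then b else 1)
  have hsub : (dihedral : Set (Equiv.Perm (List Bool))) ⊆ Set.range f := by
    have hd : ∀ x ∈ ({a, d} : Set (Equiv.Perm (List Bool))), x⁻¹ = x := by
      rintro x (rfl | rfl) <;> exact genPerm_inv _
    have step : ∀ x ∈ ({a, d} : Set (Equiv.Perm (List Bool))), ∀ y ∈ Set.range f,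
        x * y ∈ Set.range f := by
      have haa : a * a = 1 := genPerm_mul_self _
      have hbb : b * b = 1 := genPerm_mul_self _
      have hda : ∀ x y, d * (a * pair (x, y)) = a * pair (b * x, y) := by
        intro x y
        have : d * a = a * pair (b, 1) := by
          rw [← a_mul_pair_mul_a, ← d_eq]
          simp only [← mul_assoc, haa, one_mul]
        rw [← mul_assoc, this, mul_assoc, ← map_mul]
        simp
      have hdp : ∀ x y, d * pair (x, y) = pair (x, b * y) := by
        intro x y
        rw [d_eq, ← map_mul]
        simp
      rintro x (rfl | rfl) _ ⟨⟨p, q, r⟩, rfl⟩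
      · refine ⟨(!p, q, r), ?_⟩
        cases p <;> simp [f, ← mul_assoc, haa]
      · cases p
        · refine ⟨(false, q, !r), ?_⟩
          cases r <;> simp [f, hdp, hbb]
        · refine ⟨(true, !q, r), ?_⟩
          cases q <;> simp [f, hda, hbb]
    intro x hx
    refine Subgroup.closure_induction_left (p := fun x _ => x ∈ Set.range f) ?_ ?_ ?_ hx
    · exact ⟨(false, false, false), by ext1 (_ | ⟨_ | _, w⟩) <;> rfl⟩
    · intro x hx y _ hy
      exact step x hx y hy
    · intro x hx y _ hy
      rw [hd x hx]
      exact step x hx y hy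
  exact Set.Finite.subset (Set.finite_range f) hsub

/-- The elements of the group of the form `(x, g)`, with `x` in the dihedral group. -/
def dihedralPairs : Subgroup (Equiv.Perm (List Bool) × Equiv.Perm (List Bool)) :=
  grigorchukGroup.comap pair ⊓ dihedral.prod ⊤

theorem le_map_dihedralPairs :
    grigorchukGroup ≤ dihedralPairs.map (MonoidHom.snd _ _) := by
  have ha : a ∈ dihedral := Subgroup.subset_closure (by simp)
  have hd : d ∈ dihedral := Subgroup.subset_closure (by simp)
  have hb' : pair (a, c) ∈ grigorchukGroup := b_eq ▸ genPerm_mem .b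
  have hc' : pair (a, d) ∈ grigorchukGroup := c_eq ▸ genPerm_mem .c
  have hd' : pair (1, b) ∈ grigorchukGroup := d_eq ▸ genPerm_mem .d
  refine (Subgroup.closure_le _).2 ?_
  rintro _ ⟨s, rfl⟩
  cases s
  · exact ⟨(d, a), ⟨pair_swap_mem hc', hd, trivial⟩, rfl⟩
  · exact ⟨(1, b), ⟨hd', one_mem _, trivial⟩, rfl⟩
  · exact ⟨(a, c), ⟨hb', ha, trivial⟩, rfl⟩
  · exact ⟨(a, d), ⟨hc', ha, trivial⟩, rfl⟩

/-- The pairs `(x, g)` in `Γ` with `x` in the finite dihedral group project onto a subgroup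
containing `Γ`, and those with `x = 1` have finite index among them. A `relIndex` of `0` encodes
infinite index. -/
theorem relIndex_comap_right_self :
    (grigorchukGroup.comap right).relIndex grigorchukGroup ≠ 0 := by
  have h1 : (MonoidHom.fst (Equiv.Perm (List Bool)) (Equiv.Perm (List Bool))).ker.relIndex
      dihedralPairs ≠ 0 := by
    rw [Subgroup.relIndex_ker]
    have hle : dihedralPairs.map (MonoidHom.fst _ _) ≤ dihedral := by
      rintro _ ⟨x, hx, rfl⟩
      exact hx.2.1
    have : Finite (dihedralPairs.map (MonoidHom.fst _ _)) :=
      Finite.of_injective _ (Subgroup.inclusion_injective hle)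
    exact Nat.card_pos.ne'
  have h2 : ((grigorchukGroup.comap right).comap (MonoidHom.snd (Equiv.Perm (List Bool)) _)).relIndex
      dihedralPairs ≠ 0 := by
    rw [← Subgroup.inf_relIndex_right] at h1
    refine ne_zero_of_dvd_ne_zero h1 (Subgroup.relIndex_dvd_of_le_left _ ?_)
    rintro ⟨x, g⟩ ⟨hx, hg⟩
    obtain rfl : x = 1 := hx
    exact hg.1
  rw [Subgroup.relIndex_comap] at h2
  exact Subgroup.relIndex_ne_zero_trans h2
    (by rw [Subgroup.relIndex_eq_one.2 le_map_dihedralPairs]; exact one_ne_zero)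

theorem relIndex_comap_left_self :
    (grigorchukGroup.comap left).relIndex grigorchukGroup ≠ 0 := by
  have : grigorchukGroup.comap left = grigorchukGroup.comap right := by
    ext g
    exact ⟨fun h => pair_swap_mem h, fun h => pair_swap_mem h⟩
  rw [this]
  exact relIndex_comap_right_self

theorem relIndex_comap_ne_zero {f : Equiv.Perm (List Bool) →* Equiv.Perm (List Bool)}
    (hf : (grigorchukGroup.comap f).relIndex grigorchukGroup ≠ 0)
    {L : Subgroup (Equiv.Perm (List Bool))} (hL : L.relIndex grigorchukGroup ≠ 0) :
    (L.comap f).relIndex grigorchukGroup ≠ 0 := by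
  rw [Subgroup.relIndex_comap] at hf ⊢
  exact Subgroup.relIndex_ne_zero_trans hL hf

/-! ### Direct powers -/

/-- The product of the copies of the `f i` acting below the vertices `1ⁱ0`. -/
def comb : (M : ℕ) → (Fin M → Equiv.Perm (List Bool)) →* Equiv.Perm (List Bool)
  | 0 => 1
  | M + 1 => pair.comp ((Pi.evalMonoidHom _ 0).prod
      ((comb M).comp (MonoidHom.pi fun i => Pi.evalMonoidHom _ i.succ)))

theorem comb_succ (M : ℕ) (f : Fin (M + 1) → Equiv.Perm (List Bool)) :
    comb (M + 1) f = pair (f 0, comb M fun i => f i.succ) := rfl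

theorem comb_injective (M : ℕ) : Function.Injective (comb M) := by
  induction M with
  | zero => exact Function.injective_of_subsingleton _
  | succ M ih =>
    intro f g h
    rw [comb_succ, comb_succ] at h
    obtain ⟨h0, h1⟩ := Prod.ext_iff.1 (pair_injective h)
    have h2 := ih h1
    ext1 i
    refine Fin.cases h0 (fun j => congrFun h2 j) i

theorem exists_comb_mem (M : ℕ) {L : Subgroup (Equiv.Perm (List Bool))}
    (hL : L.relIndex grigorchukGroup ≠ 0) :
    ∃ K : Subgroup (Equiv.Perm (List Bool)), K.relIndex grigorchukGroup ≠ 0 ∧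
      ∀ f : Fin M → Equiv.Perm (List Bool), (∀ i, f i ∈ K) → comb M f ∈ L := by
  induction M generalizing L with
  | zero => exact ⟨L, hL, fun f _ => one_mem L⟩
  | succ M ih =>
    obtain ⟨K, hK, h⟩ := ih (relIndex_comap_ne_zero relIndex_comap_right_self hL)
    refine ⟨K ⊓ L.comap left, Subgroup.relIndex_inf_ne_zero hK
      (relIndex_comap_ne_zero relIndex_comap_left_self hL), fun f hf => ?_⟩
    rw [comb_succ, ← left_mul_right]
    exact mul_mem (hf 0).2 (h _ fun i => (hf i.succ).1)

/-! ### The group is infinite -/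

/-- A choice of `(x, g) ∈ Γ` for each `g` is an injective self-map of `Γ` that misses `a`, since `a`
moves the vertex `0`. -/
theorem infinite_grigorchukGroup : Infinite grigorchukGroup := by
  have h : ∀ g : grigorchukGroup, ∃ x, pair (x, g.1) ∈ grigorchukGroup := by
    intro g
    obtain ⟨⟨x, y⟩, hx, hy⟩ := le_map_dihedralPairs g.2
    obtain rfl : y = g.1 := hy
    exact ⟨x, hx.1⟩
  choose x hx using h
  let F : grigorchukGroup → grigorchukGroup := fun g => ⟨pair (x g, g.1), hx g⟩
  have hinj : Function.Injective F := by
    intro g g' hg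
    have := pair_injective (congrArg Subtype.val hg)
    exact Subtype.ext (Prod.ext_iff.1 this).2
  by_contra hfin
  rw [not_infinite_iff_finite] at hfin
  obtain ⟨g, hg⟩ := Finite.surjective_of_injective hinj ⟨a, genPerm_mem .a⟩
  have := congrArg (fun e : grigorchukGroup => e.1 [false]) hg
  simp [F, genPerm_apply, act] at this

theorem exists_mem_ne {L : Subgroup (Equiv.Perm (List Bool))}
    (hL : L.relIndex grigorchukGroup ≠ 0) : ∃ y ∈ L, y ≠ 1 ∧ y ≠ a := by
  by_contra! hcon
  have hfin : Finite (L.subgroupOf grigorchukGroup) := by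
    have hs : (L : Set (Equiv.Perm (List Bool))) ⊆ {1, a} := by
      intro y hy
      by_cases h : y = 1
      · simp [h]
      · simp [hcon y hy h]
    have : Finite L := (Set.toFinite _).subset hs
    exact Finite.of_injective (fun y => (⟨y.1.1, y.2⟩ : L)) fun y z h =>
      Subtype.ext (Subtype.ext (Subtype.mk.inj h))
  have hfi : (L.subgroupOf grigorchukGroup).index ≠ 0 := hL
  have := infinite_grigorchukGroup
  have h0 : Nat.card grigorchukGroup = 0 := Nat.card_eq_zero_of_infinite
  rw [← Subgroup.card_mul_index (L.subgroupOf grigorchukGroup)] at h0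
  rcases mul_eq_zero.1 h0 with h | h
  · exact Nat.card_pos.ne' h
  · exact hfi h

end Grigorchuk

namespace Grigorchuk

/-! ### Action along the ray `111…` -/

/-- The subgroup generated by `b`, `c` and `d`. -/
def germ : Subgroup (Equiv.Perm (List Bool)) := Subgroup.closure {b, c, d}

theorem germ_right {t} (ht : t ∈ germ) : ∃ t' ∈ germ, ∀ w, t (true :: w) = true :: t' w := by
  have hb : b ∈ germ := Subgroup.subset_closure (by simp)
  have hc : c ∈ germ := Subgroup.subset_closure (by simp)
  have hd : d ∈ germ := Subgroup.subset_closure (by simp)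
  induction ht using Subgroup.closure_induction with
  | mem x hx =>
    rcases hx with rfl | rfl | rfl
    · exact ⟨c, hc, fun w => rfl⟩
    · exact ⟨d, hd, fun w => rfl⟩
    · exact ⟨b, hb, fun w => rfl⟩
  | one => exact ⟨1, one_mem _, fun w => rfl⟩
  | mul x y _ _ hx hy =>
    obtain ⟨x', hx', hx⟩ := hx
    obtain ⟨y', hy', hy⟩ := hy
    exact ⟨x' * y', mul_mem hx' hy', fun w => by simp [hx, hy]⟩
  | inv x _ hx =>
    obtain ⟨x', hx', hx⟩ := hx
    refine ⟨x'⁻¹, inv_mem hx', fun w => ?_⟩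
    rw [Equiv.Perm.inv_eq_iff_eq, hx]
    simp

theorem germ_left {t} (ht : t ∈ germ) :
    ∃ t' : Equiv.Perm (List Bool), (t' = 1 ∨ t' = a) ∧ ∀ w, t (false :: w) = false :: t' w := by
  have haa : a * a = 1 := genPerm_mul_self _
  induction ht using Subgroup.closure_induction with
  | mem x hx =>
    rcases hx with rfl | rfl | rfl
    · exact ⟨a, .inr rfl, fun w => rfl⟩
    · exact ⟨a, .inr rfl, fun w => rfl⟩
    · exact ⟨1, .inl rfl, fun w => rfl⟩
  | one => exact ⟨1, .inl rfl, fun w => rfl⟩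
  | mul x y _ _ hx hy =>
    obtain ⟨x', hx', hx⟩ := hx
    obtain ⟨y', hy', hy⟩ := hy
    refine ⟨x' * y', ?_, fun w => by simp [hx, hy]⟩
    rcases hx' with rfl | rfl <;> rcases hy' with rfl | rfl <;> simp [haa]
  | inv x _ hx =>
    obtain ⟨x', hx', hx⟩ := hx
    refine ⟨x'⁻¹, ?_, fun w => ?_⟩
    · rcases hx' with rfl | rfl
      · simp
      · exact .inr (genPerm_inv _)
    · rw [Equiv.Perm.inv_eq_iff_eq, hx]
      simp

/-- The section of a generator at a word ending in `1` is never `a` itself: `a` arises as a section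
only just after a `0`, or at the empty word. -/
theorem act_append_true (s : Gen) (u : List Bool) :
    ∃ u' : List Bool, ∃ t ∈ germ, u'.length = u.length + 1 ∧
      ∀ w, act s (u ++ true :: w) = u' ++ t w := by
  have hb : b ∈ germ := Subgroup.subset_closure (by simp)
  have hc : c ∈ germ := Subgroup.subset_closure (by simp)
  have hd : d ∈ germ := Subgroup.subset_closure (by simp)
  induction u generalizing s with
  | nil =>
    cases s
    · exact ⟨[false], 1, one_mem _, rfl, fun w => rfl⟩
    · exact ⟨[true], c, hc, rfl, fun w => rfl⟩
    · exact ⟨[true], d, hd, rfl, fun w => rfl⟩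
    · exact ⟨[true], b, hb, rfl, fun w => rfl⟩
  | cons x u ih =>
    have key : ∀ s s', (∀ w, act s (x :: w) = x :: act s' w) → ∃ u' : List Bool, ∃ t ∈ germ,
        u'.length = (x :: u).length + 1 ∧ ∀ w, act s (x :: u ++ true :: w) = u' ++ t w := by
      intro s s' h
      obtain ⟨u', t, ht, hl, hu⟩ := ih s'
      exact ⟨x :: u', t, ht, by simp [hl], fun w => by simp [h, hu]⟩
    cases s
    · exact ⟨(!x) :: u ++ [true], 1, one_mem _, by simp, fun w => by simp [act]⟩
    · cases x
      · exact key _ .a fun w => rfl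
      · exact key _ .c fun w => rfl
    · cases x
      · exact key _ .a fun w => rfl
      · exact key _ .d fun w => rfl
    · cases x
      · exact ⟨false :: u ++ [true], 1, one_mem _, by simp, fun w => by simp [act]⟩
      · exact key _ .b fun w => rfl

/-- At the first `0` the section becomes `a` or `1`, and one letter later it is trivial; the
appended `true` guarantees that letter. -/
theorem act_append_true_of_mem {s : Gen} (hs : s ≠ .a) {u : List Bool} (hu : false ∈ u) :
    ∃ u' : List Bool, u'.length = u.length + 1 ∧ ∀ w, act s (u ++ true :: w) = u' ++ w := by
  have ha : ∀ u : List Bool, ∃ u' : List Bool, u'.length = u.length + 1 ∧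
      ∀ w, act .a (u ++ true :: w) = u' ++ w := by
    rintro (_ | ⟨x, u⟩)
    · exact ⟨[false], rfl, fun w => rfl⟩
    · exact ⟨(!x) :: u ++ [true], by simp, fun w => by simp [act]⟩
  induction u generalizing s with
  | nil => simp at hu
  | cons x u ih =>
    have key : ∀ s s', (∀ w, act s (x :: w) = x :: act s' w) →
        (∃ u' : List Bool, u'.length = u.length + 1 ∧ ∀ w, act s' (u ++ true :: w) = u' ++ w) →
        ∃ u' : List Bool, u'.length = (x :: u).length + 1 ∧
          ∀ w, act s (x :: u ++ true :: w) = u' ++ w := by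
      rintro s s' h ⟨u', hl, hu⟩
      exact ⟨x :: u', by simp [hl], fun w => by simp [h, hu]⟩
    cases x
    · cases s
      · exact absurd rfl hs
      · exact key _ .a (fun w => rfl) (ha u)
      · exact key _ .a (fun w => rfl) (ha u)
      · exact ⟨false :: u ++ [true], by simp, fun w => by simp [act]⟩
    · have hu' : false ∈ u := by simpa using hu
      cases s
      · exact absurd rfl hs
      · exact key _ .c (fun w => rfl) (ih (by simp) hu')
      · exact key _ .d (fun w => rfl) (ih (by simp) hu')
      · exact key _ .b (fun w => rfl) (ih (by simp) hu')

theorem act_replicate {s : Gen} (hs : s ≠ .a) (N : ℕ) :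
    ∃ s' : Gen, s' ≠ .a ∧
      ∀ w, act s (List.replicate N true ++ w) = List.replicate N true ++ act s' w := by
  induction N generalizing s with
  | zero => exact ⟨s, hs, fun w => rfl⟩
  | succ N ih =>
    have key : ∀ s s', s' ≠ .a → (∀ w, act s (true :: w) = true :: act s' w) → ∃ s' : Gen, s' ≠ .a ∧
        ∀ w, act s (List.replicate (N + 1) true ++ w) =
          List.replicate (N + 1) true ++ act s' w := by
      intro s s' hs' h
      obtain ⟨s'', hs'', h'⟩ := ih hs'
      exact ⟨s'', hs'', fun w => by simp [List.replicate_succ, h, h']⟩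
    cases s
    · exact absurd rfl hs
    · exact key _ .c (by simp) fun w => rfl
    · exact key _ .d (by simp) fun w => rfl
    · exact key _ .b (by simp) fun w => rfl

theorem exists_act_ne {s : Gen} (hs : s ≠ .a) : ∃ w, act s w ≠ w := by
  cases s
  · exact absurd rfl hs
  · exact ⟨[false, false], by simp [act]⟩
  · exact ⟨[false, false], by simp [act]⟩
  · exact ⟨[true, false, false], by simp [act]⟩

theorem exists_section {g} (hg : g ∈ grigorchukGroup) :
    ∃ u : List Bool, ∃ t ∈ germ, ∀ w, g (List.replicate u.length true ++ w) = u ++ t w := by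
  have step : ∀ (s : Gen) (g : Equiv.Perm (List Bool)),
      (∃ u : List Bool, ∃ t ∈ germ, ∀ w, g (List.replicate u.length true ++ w) = u ++ t w) →
      ∃ u : List Bool, ∃ t ∈ germ,
        ∀ w, (genPerm s * g) (List.replicate u.length true ++ w) = u ++ t w := by
    rintro s g ⟨u, t, ht, h⟩
    -- Descending one more level along the ray makes the image word end in `1`, so that the section
    -- of `s` there lies in `germ`.
    obtain ⟨t₁, ht₁, h₁⟩ := germ_right ht
    obtain ⟨u', t₂, ht₂, hl, h₂⟩ := act_append_true s u
    refine ⟨u', t₂ * t₁, mul_mem ht₂ ht₁, fun w => ?_⟩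
    rw [hl, List.replicate_succ', List.append_assoc]
    simp [h, h₁, genPerm_apply, h₂]
  refine Subgroup.closure_induction_left (p := fun g _ => ∃ u : List Bool, ∃ t ∈ germ,
    ∀ w, g (List.replicate u.length true ++ w) = u ++ t w) ?_ ?_ ?_ hg
  · exact ⟨[], 1, one_mem _, fun w => rfl⟩
  · rintro _ ⟨s, rfl⟩ y _ hy
    exact step s y hy
  · rintro _ ⟨s, rfl⟩ y _ hy
    rw [genPerm_inv]
    exact step s y hy

/-- The permutations fixing the vertex `1ᴺ` whose section there lies in `germ`. -/
def raySubgroup (N : ℕ) : Subgroup (Equiv.Perm (List Bool)) where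
  carrier := {g | ∃ t ∈ germ, ∀ w, g (List.replicate N true ++ w) = List.replicate N true ++ t w}
  one_mem' := ⟨1, one_mem _, fun w => rfl⟩
  mul_mem' := by
    rintro x y ⟨t, ht, hx⟩ ⟨t', ht', hy⟩
    exact ⟨t * t', mul_mem ht ht', fun w => by simp [hx, hy]⟩
  inv_mem' := by
    rintro x ⟨t, ht, hx⟩
    refine ⟨t⁻¹, inv_mem ht, fun w => ?_⟩
    rw [Equiv.Perm.inv_eq_iff_eq, hx]
    simp

theorem raySubgroup_mono : Monotone raySubgroup := by
  refine monotone_nat_of_le_succ fun N => ?_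
  rintro g ⟨t, ht, h⟩
  obtain ⟨t', ht', h'⟩ := germ_right ht
  refine ⟨t', ht', fun w => ?_⟩
  rw [List.replicate_succ', List.append_assoc]
  simp [h, h']

/-- If `g` sent `1ⁿ` to a word `u` containing `0`, it would carry the nontrivial section of `b` at
`1ⁿ⁺¹` to the section of `b` at `u1`, which is trivial. -/
theorem exists_mem_raySubgroup {g} (hg : g ∈ grigorchukGroup) (hbg : Commute b g) :
    ∃ N, g ∈ raySubgroup N := by
  obtain ⟨u, t, ht, h⟩ := exists_section hg
  by_cases hu : false ∈ u
  · exfalso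
    obtain ⟨t', -, h'⟩ := germ_right ht
    obtain ⟨u', hl, hu'⟩ := act_append_true_of_mem (s := .b) (by simp) hu
    obtain ⟨s, hs, hs'⟩ := act_replicate (s := .b) (by simp) (u.length + 1)
    obtain ⟨w, hw⟩ := exists_act_ne hs
    have hg' : ∀ w, g (List.replicate (u.length + 1) true ++ w) = u ++ true :: t' w := by
      intro w
      rw [List.replicate_succ', List.append_assoc]
      simp [h, h']
    have e := congrArg (fun e : Equiv.Perm (List Bool) =>
      e (List.replicate (u.length + 1) true ++ w)) hbg.eq
    simp only [Equiv.Perm.mul_apply, hg', genPerm_apply, hu', hs'] at e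
    rw [List.append_cons] at e
    exact hw (t'.injective (List.append_inj e (by simp [hl])).2).symm
  · have : u = List.replicate u.length true :=
      List.eq_replicate_of_mem fun x hx => by
        cases x
        · exact absurd hx hu
        · rfl
    refine ⟨u.length, t, ht, fun w => ?_⟩
    rw [h, ← this]

theorem exists_le_raySubgroup {P : Subgroup (Equiv.Perm (List Bool))} (hP : P.FG)
    (h : ∀ g ∈ P, g ∈ grigorchukGroup ∧ Commute b g) : ∃ N, P ≤ raySubgroup N := by
  obtain ⟨S, rfl⟩ := hP
  have h' : ∀ g : S, ∃ N, g.1 ∈ raySubgroup N := fun g =>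
    have := h g (Subgroup.subset_closure g.2)
    exists_mem_raySubgroup this.1 this.2
  choose N hN using h'
  obtain ⟨M, hM⟩ := (Set.finite_range N).bddAbove
  refine ⟨M, (Subgroup.closure_le _).2 fun g hg => ?_⟩
  exact raySubgroup_mono (hM ⟨⟨g, hg⟩, rfl⟩) (hN ⟨g, hg⟩)

theorem right_iterate_apply (k : ℕ) (g : Equiv.Perm (List Bool)) (w : List Bool) :
    (right^[k] g) (List.replicate k true ++ w) = List.replicate k true ++ g w := by
  induction k generalizing g with
  | zero => rfl
  | succ k ih =>
    rw [Function.iterate_succ_apply', List.replicate_succ, right_apply]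
    simp [ih]

theorem commute_pair {f g f' g'} (h : Commute f f') (h' : Commute g g') :
    Commute (pair (f, g)) (pair (f', g')) :=
  Commute.map (Prod.commute_iff.2 ⟨h, h'⟩) pair

/-- Along `1, 11, 111` the sections of `b` are `c, d, b`, so at `1^(3N+2)` the section is `d = (1,
b)`, which commutes with everything supported below `0`. -/
theorem commute_b_right_iterate (N : ℕ) (y : Equiv.Perm (List Bool)) :
    Commute b (right^[3 * N + 2] (left y)) := by
  have hd : Commute d (left y) := by
    rw [d_eq, left_apply]
    exact commute_pair (Commute.one_left _) (Commute.one_right _)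
  have hc : ∀ z, Commute d z → Commute c (right z) := fun z hz => by
    rw [c_eq, right_apply]
    exact commute_pair (Commute.one_right _) hz
  have hb : ∀ z, Commute c z → Commute b (right z) := fun z hz => by
    rw [b_eq, right_apply]
    exact commute_pair (Commute.one_right _) hz
  have hdd : ∀ z, Commute b z → Commute d (right z) := fun z hz => by
    rw [d_eq, right_apply]
    exact commute_pair (Commute.one_right _) hz
  induction N with
  | zero => exact hb _ (hc _ hd)
  | succ N ih =>
    rw [show 3 * (N + 1) + 2 = (3 * N + 2) + 1 + 1 + 1 by ring]
    iterate 3 rw [Function.iterate_succ_apply']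
    exact hb _ (hc _ (hdd _ ih))

/-- Elements of `germ` act below `0` as `1` or `a`, so a copy of any other `y`, placed deep enough
below the ray, avoids `raySubgroup N`. Finite index of `L` in the infinite group `Γ` supplies such a
`y`. -/
theorem exists_commute_notMem_raySubgroup {L : Subgroup (Equiv.Perm (List Bool))}
    (hL : L.relIndex grigorchukGroup ≠ 0) (N : ℕ) :
    ∃ g ∈ L, Commute b g ∧ g ∉ raySubgroup N := by
  have hk : ∀ k : ℕ, ∀ L : Subgroup (Equiv.Perm (List Bool)), L.relIndex grigorchukGroup ≠ 0 →
      ∃ y, right^[k] (left y) ∈ L ∧ y ≠ 1 ∧ y ≠ a := by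
    intro k
    induction k with
    | zero =>
      intro L hL
      exact exists_mem_ne (relIndex_comap_ne_zero relIndex_comap_left_self hL)
    | succ k ih =>
      intro L hL
      obtain ⟨y, hy, h⟩ := ih _ (relIndex_comap_ne_zero relIndex_comap_right_self hL)
      exact ⟨y, by rw [Function.iterate_succ_apply']; exact hy, h⟩
  obtain ⟨y, hy, hy1, hya⟩ := hk (3 * N + 2) L hL
  refine ⟨_, hy, commute_b_right_iterate N y, fun hmem => ?_⟩
  obtain ⟨t, ht, h⟩ := raySubgroup_mono (show N ≤ 3 * N + 2 by omega) hmem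
  obtain ⟨t', ht', h'⟩ := germ_left ht
  have : y = t' := by
    ext1 w
    have := h (false :: w)
    rw [right_iterate_apply, h', List.append_cancel_left_eq, left_apply] at this
    simpa using this
  rcases ht' with rfl | rfl
  · exact hy1 this
  · exact hya this

end Grigorchuk

open Grigorchuk in
theorem mainTheorem6 : IntersectionSaturated grigorchukGroup := by
  refine IntersectionSaturated.of_direct_powers fun M => ?_
  obtain ⟨K, hK, hcomb⟩ := exists_comb_mem M (L := grigorchukGroup) (by simp)
  have : (K.subgroupOf grigorchukGroup).FiniteIndex := ⟨hK⟩
  -- Normality lets conjugation by `b` act on `H`; finite index keeps `H` finitely generated.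
  let H : Subgroup grigorchukGroup := (K.subgroupOf grigorchukGroup).normalCore
  have hH : H.FiniteIndex := inferInstance
  have hHK : ∀ x ∈ H, x.1 ∈ K := fun x hx => Subgroup.normalCore_le (K.subgroupOf grigorchukGroup) hx
  let β : grigorchukGroup := ⟨b, genPerm_mem .b⟩
  let φ : H ≃* H := MulAut.conjNormal β
  have hφ : ∀ x : H, x ∈ φ.fixedSubgroup ↔ Commute b x.1.1 := by
    intro x
    have h1 : x ∈ φ.fixedSubgroup ↔ φ x = x := Iff.rfl
    rw [h1, Subtype.ext_iff, MulAut.conjNormal_apply, Subtype.ext_iff]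
    exact mul_inv_eq_iff_eq_mul
  let ε : H →* Equiv.Perm (List Bool) := grigorchukGroup.subtype.comp H.subtype
  let f : (Fin M → H) →* grigorchukGroup :=
    ((comb M).comp (MonoidHom.pi fun i => ε.comp (Pi.evalMonoidHom _ i))).codRestrict _
      fun x => hcomb _ fun i => hHK _ (x i).2
  refine ⟨H, φ, f, (Group.fg_iff_subgroup_fg H).1 inferInstance, ?_, fun hfg => ?_⟩
  · intro x y hxy
    have := comb_injective M (congrArg Subtype.val hxy)
    ext1 i
    exact Subtype.ext (Subtype.ext (congrFun this i))
  · obtain ⟨N, hN⟩ := exists_le_raySubgroup (hfg.map_hom ε) (by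
      rintro _ ⟨x, hx, rfl⟩
      exact ⟨x.1.2, (hφ x).1 hx⟩)
    have hL : (H.map grigorchukGroup.subtype).relIndex grigorchukGroup ≠ 0 := by
      have : (H.map grigorchukGroup.subtype).subgroupOf grigorchukGroup = H :=
        Subgroup.comap_map_eq_self_of_injective grigorchukGroup.subtype_injective H
      rw [Subgroup.relIndex, this]
      exact hH.index_ne_zero
    obtain ⟨_, ⟨x, hx, rfl⟩, hbx, hnot⟩ := exists_commute_notMem_raySubgroup hL N
    exact hnot (hN ⟨⟨x, hx⟩, (hφ ⟨x, hx⟩).2 hbx, rfl⟩)
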